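/- A permutation $\pi=\pi_1\cdots\pi_n$ (in one-line notation) is a \emph{Fishburn permutation} if there are no indices $j,k$ with $j+1<k$, $\pi_j=\pi_k+1$ and $\pi_{j+1}>\pi_j$. For $n\ge 0$ let $F_n(321,3124)$ be the set of Fishburn permutations of length $n$ that avoid the patterns $321$ and $3124$. Let $\mathrm{ltrmax}(\pi)$ be the number of left-to-right maxima of $\pi$, that is, of entries greater than all entries to their left, and put $$T(t,x)=\sum_{n\ge 0}\ \sum_{\pi\in F_n(321,3124)}t^{\mathrm{ltrmax}(\pi)}x^n\in\mathbb Z[t][[x]].$$ Let $F_m$ be the Fibonacci numbers with $F_0=F_1=1$ and $F_m=F_{m-1}+F_{m-2}$ for $m\ge 2$. Say that a permutation $\pi$ of length $n$ has label $(1a)$ if its last two entries are $n,\,n-1$ or if $\pi$ is empty; label $(1b)$ if $\pi$ contains the pattern $312$; and, for an integer $k\ge 2$, label $(k)$ if $\pi$ avoids $312$ and either the last $k$ entries of $\pi$ are $a,\,n-k+2,\,n-k+3,\dots,n$ with $a\le n-k$, or $\pi=12\cdots n$ and $k=n+1$. Then the following hold. (1) For every $n\ge 0$, every $\pi\in F_n(321,3124)$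 has exactly one label. For every $n\ge 1$, every permutation in $F_{n+1}(321,3124)$ arises from exactly one $\pi\in F_n(321,3124)$ by inserting $n+1$ into exactly one site (before the first entry, between two entries, or after the last entry). Thus the permutations in the sets $F_n(321,3124)$, $n\ge 1$, form a rooted tree, in which the children of $\pi\in F_n(321,3124)$ are the elements of $F_{n+1}(321,3124)$ obtained by inserting $n+1$ into $\pi$. The root, the permutation $1$, has label $(2)$, and the labels of the children of a node are determined, with multiplicities, by the label of the node through the rules $$(1a)\to(2),\qquad (1b)\to(1b),\qquad (k)\to\underbrace{(1b),\dots,(1b)}_{k-2},(1a),(k+1)\quad(k\ge 2).$$ Infinitely many labels occur in this tree. (2) $$T(t,x)=\frac{1-(t+1)x+tx^2+tx^3}{(1-tx-tx^2)(1-tx)(1-x)}.$$ (3) For every $n\ge 0$, $|F_n(321,3124)|=F_{n+2}-n-1$. -/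

import Mathlib

/-!
Permutations of length `n` are elements of `Equiv.Perm (Fin n)`, read in one-line notation:
the entry in position `i` is `π i`.  Positions and entries run over `0, …, n-1`, so that
they are one less than in the usual notation with `1, …, n`.
-/

namespace FishburnTree

/-- `π` contains the word `p` as a pattern: some subsequence of `π` has the same length and
relative order as `p`. -/
def Contains {k n : ℕ} (p : Fin k → ℕ) (π : Equiv.Perm (Fin n)) : Prop :=
  ∃ f : Fin k ↪o Fin n, ∀ i j : Fin k, π (f i) < π (f j) ↔ p i < p j

/-- `π` is a Fishburn permutation: there are no positions `j`, `j + 1`, `k` with `j + 1 < k`,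
`π_j = π_k + 1` and `π_{j+1} > π_j`. -/
def IsFishburn {n : ℕ} (π : Equiv.Perm (Fin n)) : Prop :=
  ¬ ∃ j j' k : Fin n, (j' : ℕ) = (j : ℕ) + 1 ∧ j' < k ∧
    (π j : ℕ) = (π k : ℕ) + 1 ∧ π j < π j'

open Classical in
/-- The set `F_n(321, 3124)` of Fishburn permutations of length `n` avoiding `321` and `3124`. -/
noncomputable def F (n : ℕ) : Finset (Equiv.Perm (Fin n)) :=
  Finset.univ.filter fun π =>
    IsFishburn π ∧ ¬ Contains ![3, 2, 1] π ∧ ¬ Contains ![3, 1, 2, 4] π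

/-- The number of left-to-right maxima: entries greater than all entries to their left. -/
def ltrMax {n : ℕ} (π : Equiv.Perm (Fin n)) : ℕ :=
  (Finset.univ.filter fun j : Fin n => ∀ i : Fin n, i < j → π i < π j).card

/-- The generating function `T(t,x) = ∑_n ∑_{π ∈ F_n(321,3124)} t^{ltrMax π} x^n`,
a power series in `x` over the polynomial ring `ℤ[t]`. -/
noncomputable def T : PowerSeries (Polynomial ℤ) :=
  PowerSeries.mk fun n => ∑ π ∈ F n, (Polynomial.X : Polynomial ℤ) ^ ltrMax π

/-- Fibonacci numbers, indexed so that `F_0 = F_1 = 1`. -/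
def fibonacci (n : ℕ) : ℕ := Nat.fib (n + 1)

theorem fibonacci_zero : fibonacci 0 = 1 := rfl

theorem fibonacci_one : fibonacci 1 = 1 := rfl

theorem fibonacci_add_two (n : ℕ) : fibonacci (n + 2) = fibonacci (n + 1) + fibonacci n := by
  rw [Nat.add_comm (fibonacci (n + 1))]
  exact Nat.fib_add_two

/-- Insert a new largest entry into the site `i` of `π`, the site just before the position `i`
(after the last entry if `i = n`). -/
def insertMax {n : ℕ} (π : Equiv.Perm (Fin n)) (i : Fin (n + 1)) : Equiv.Perm (Fin (n + 1)) :=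
  (finSuccEquiv' i).trans ((Equiv.optionCongr π).trans (finSuccEquiv' (Fin.last n)).symm)

theorem insertMax_self {n : ℕ} (π : Equiv.Perm (Fin n)) (i : Fin (n + 1)) :
    insertMax π i i = Fin.last n := by
  simp [insertMax]

theorem insertMax_succAbove {n : ℕ} (π : Equiv.Perm (Fin n)) (i : Fin (n + 1)) (j : Fin n) :
    insertMax π i (i.succAbove j) = (π j).castSucc := by
  simp [insertMax]

open Classical in
/-- The active sites of `π` with respect to a family `C` of sets of permutations: the sites into
which a new largest entry can be inserted so that the result is again in `C`. -/
noncomputable def activeSites (C : (n : ℕ) → Finset (Equiv.Perm (Fin n))) {n : ℕ}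
    (π : Equiv.Perm (Fin n)) : Finset (Fin (n + 1)) :=
  Finset.univ.filter fun i => insertMax π i ∈ C (n + 1)

/-- With the labels `lbl`, the nonempty permutations in `C` form the generating tree with root
label `root` and succession rule `rule`.  The children of `π` are the permutations in `C` obtained
by inserting a new largest entry into `π`; the root is the only permutation of length `1` in `C`;
every longer permutation in `C` arises from exactly one parent and one site; and the labels of the
children of `π` are, with multiplicities, those that `rule` assigns to the label of `π`. -/
def IsGeneratingTree {L : Type} (C : (n : ℕ) → Finset (Equiv.Perm (Fin n)))
    (lbl : (n : ℕ) → Equiv.Perm (Fin n) → L) (root : L) (rule : L → Multiset L) : Prop :=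
  (C 1).val.map (lbl 1) = {root} ∧
  (∀ n : ℕ, 1 ≤ n → ∀ τ ∈ C (n + 1),
    ∃! p : Equiv.Perm (Fin n) × Fin (n + 1), p.1 ∈ C n ∧ insertMax p.1 p.2 = τ) ∧
  (∀ n : ℕ, 1 ≤ n → ∀ π ∈ C n,
    (activeSites C π).val.map (fun i => lbl (n + 1) (insertMax π i)) = rule (lbl n π))

/-- The labels (1a), (1b) and (k). -/
inductive Label where
  | oneA : Label
  | oneB : Label
  | num : ℕ → Label

/-- What it means for a permutation of length `n` to have a given label, with entries written as
`1, …, n`: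
(1a): the last two entries are `n, n-1`, or `π` is empty;
(1b): `π` contains `312`;
(k), for `k ≥ 2`: `π` avoids `312` and its last `k` entries are `a, n-k+2, n-k+3, …, n` with
`a ≤ n-k`, where an increasing permutation of length `n ≥ 1` is read as if preceded by an
entry `a`, so that it has the label (n+1). -/
def HasLabel {n : ℕ} (π : Equiv.Perm (Fin n)) : Label → Prop
  | .oneA => n = 0 ∨ ∃ i j : Fin n, (i : ℕ) + 2 = n ∧ (j : ℕ) + 1 = n ∧
      (π i : ℕ) + 1 = n ∧ (π j : ℕ) + 2 = n
  | .oneB => Contains ![3, 1, 2] π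
  | .num k => 2 ≤ k ∧ k ≤ n + 1 ∧ ¬ Contains ![3, 1, 2] π ∧
      (∀ i : Fin n, n + 1 ≤ (i : ℕ) + k → π i = i) ∧
      (∀ i : Fin n, (i : ℕ) + k = n → (π i : ℕ) + 1 ≤ n - k)

/-- The succession rule `(1a) → (2)`, `(1b) → (1b)`, `(k) → (1b)^{k-2}, (1a), (k+1)`. -/
def rule : Label → Multiset Label
  | .oneA => {.num 2}
  | .oneB => {.oneB}
  | .num k => Multiset.replicate (k - 2) .oneB + {.oneA, .num (k + 1)}

end FishburnTree

namespace FishburnTree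

/-! Every permutation of length `n + 1` arises uniquely by inserting a maximum into one of length
`n`, and deleting the maximum preserves the class. So everything reduces to finding the active
sites. By `insertMax_mem_F_iff`, a site is active exactly when the entries after it increase (no
321), the entries before it avoid 312 (no 3124), and the entry just before it is not one more than
an entry after it (Fishburn).

The Fishburn condition enters mainly through `IsFishburn.exists_min_inversion`: a descent-like
defect at a position b comes from an entry immediately before b or else produces a 312 ending at b.
This settles three cases. If the maximum is last, the final run of fixed points has k - 1 entries
and the active sites are the last k. Otherwise there is exactly one active site, and it depends on
whether the second largest entry stands before or after the maximum.

For the generating function the label is paired with the number of left-to-right maxima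
(`stateRule`). The infinitely many labels (k) are tamed by one extra statistic D, the weight of the
(1b)-children that label (k) is about to produce. It grows by exactly the weight of the (k)-node at
each step, so the series A, B, K, D of the weights satisfy a closed linear system: A = 1 + xK, B =
x(tB + D), K = tx(A + K), D = x(D + K), with T = A + B + K. At t = 1 the recurrences give Fibonacci
numbers and their partial sums. -/

/-! ### Patterns as inequalities between positions -/

theorem contains_321_iff {n : ℕ} (π : Equiv.Perm (Fin n)) :
    Contains ![3, 2, 1] π ↔ ∃ a b c : Fin n, a < b ∧ b < c ∧ π c < π b ∧ π b < π a := by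
  constructor
  · rintro ⟨f, hf⟩
    exact ⟨f 0, f 1, f 2, by simp, by simp, (hf 2 1).2 (by simp), (hf 1 0).2 (by simp)⟩
  · rintro ⟨a, b, c, hab, hbc, h1, h2⟩
    refine ⟨OrderEmbedding.ofStrictMono ![a, b, c] ?_, ?_⟩
    · simp [Fin.strictMono_iff_lt_succ, Fin.forall_fin_succ, hab, hbc]
    · simp [Fin.forall_fin_succ, h1, h2, h1.trans h2, h1.le, h2.le, (h1.trans h2).le]

theorem contains_312_iff {n : ℕ} (π : Equiv.Perm (Fin n)) :
    Contains ![3, 1, 2] π ↔ ∃ a b c : Fin n, a < b ∧ b < c ∧ π b < π c ∧ π c < π a := by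
  constructor
  · rintro ⟨f, hf⟩
    exact ⟨f 0, f 1, f 2, by simp, by simp, (hf 1 2).2 (by simp), (hf 2 0).2 (by simp)⟩
  · rintro ⟨a, b, c, hab, hbc, h1, h2⟩
    refine ⟨OrderEmbedding.ofStrictMono ![a, b, c] ?_, ?_⟩
    · simp [Fin.strictMono_iff_lt_succ, Fin.forall_fin_succ, hab, hbc]
    · simp [Fin.forall_fin_succ, h1, h2, h1.trans h2, h1.le, h2.le, (h1.trans h2).le]

theorem contains_3124_iff {n : ℕ} (π : Equiv.Perm (Fin n)) :
    Contains ![3, 1, 2, 4] π ↔ ∃ a b c d : Fin n, a < b ∧ b < c ∧ c < d ∧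
      π b < π c ∧ π c < π a ∧ π a < π d := by
  constructor
  · rintro ⟨f, hf⟩
    exact ⟨f 0, f 1, f 2, f 3, by simp, by simp, f.lt_iff_lt.2 (by decide),
      (hf 1 2).2 (by simp), (hf 2 0).2 (by simp), (hf 0 3).2 (by simp)⟩
  · rintro ⟨a, b, c, d, hab, hbc, hcd, h1, h2, h3⟩
    refine ⟨OrderEmbedding.ofStrictMono ![a, b, c, d] ?_, ?_⟩
    · simp [Fin.strictMono_iff_lt_succ, Fin.forall_fin_succ, hab, hbc, hcd]
    · simp [Fin.forall_fin_succ, h1, h2, h3, h1.trans h2, h1.le, h2.le, h3.le, (h1.trans h2).le,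
        h2.trans h3, (h2.trans h3).le, (h1.trans (h2.trans h3)).le, h1.trans (h2.trans h3)]

theorem not_contains_321_iff {n : ℕ} (π : Equiv.Perm (Fin n)) :
    ¬ Contains ![3, 2, 1] π ↔
      ∀ a b c : Fin n, a < b → b < c → π c < π b → π b < π a → False := by
  rw [contains_321_iff]; push Not; grind

theorem not_contains_312_iff {n : ℕ} (π : Equiv.Perm (Fin n)) :
    ¬ Contains ![3, 1, 2] π ↔
      ∀ a b c : Fin n, a < b → b < c → π b < π c → π c < π a → False := by
  rw [contains_312_iff]; push Not; grind

theorem not_contains_3124_iff {n : ℕ} (π : Equiv.Perm (Fin n)) :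
    ¬ Contains ![3, 1, 2, 4] π ↔ ∀ a b c d : Fin n, a < b → b < c → c < d →
      π b < π c → π c < π a → π a < π d → False := by
  rw [contains_3124_iff]; push Not; grind

theorem isFishburn_iff {n : ℕ} (π : Equiv.Perm (Fin n)) :
    IsFishburn π ↔ ∀ j j' k : Fin n, (j' : ℕ) = (j : ℕ) + 1 → j' < k →
      (π j : ℕ) = (π k : ℕ) + 1 → π j < π j' → False := by
  unfold IsFishburn; push Not; grind

theorem mem_F_iff {n : ℕ} (π : Equiv.Perm (Fin n)) :
    π ∈ F n ↔ IsFishburn π ∧ ¬ Contains ![3, 2, 1] π ∧ ¬ Contains ![3, 1, 2, 4] π := by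
  simp [F]

/-! ### Inserting a new maximum -/

theorem insertMax_injective (n : ℕ) :
    Function.Injective fun p : Equiv.Perm (Fin n) × Fin (n + 1) => insertMax p.1 p.2 := by
  rintro ⟨π, i⟩ ⟨σ, j⟩ h
  dsimp only at h
  have hij : i = j := by
    apply (insertMax π i).injective
    rw [insertMax_self, h, insertMax_self]
  subst hij
  have : π = σ := by
    ext k
    have := congrArg (fun τ => τ (i.succAbove k)) h
    simp only [insertMax_succAbove] at this
    simpa using congrArg Fin.val this
  rw [this]

theorem insertMax_bijective (n : ℕ) :
    Function.Bijective fun p : Equiv.Perm (Fin n) × Fin (n + 1) => insertMax p.1 p.2 := by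
  rw [Fintype.bijective_iff_injective_and_card]
  refine ⟨insertMax_injective n, ?_⟩
  simp [Fintype.card_perm, Nat.factorial_succ, mul_comm]

theorem succAbove_val {n : ℕ} (i : Fin (n + 1)) (j : Fin n) :
    (i.succAbove j : ℕ) = if (j : ℕ) < i then (j : ℕ) else j + 1 := by
  simp only [Fin.succAbove, Fin.lt_def, Fin.val_castSucc]
  split_ifs <;> simp

/-- A new maximum can only play the 3 of a 321, the 4 of a 3124, or the entry following the ascent
bottom in a Fishburn violation; these roles give the three conditions. Deletion is harmless for the
Fishburn property: if removing the maximum makes j and j' adjacent, the maximum itself already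
served as the larger successor of j. -/
theorem insertMax_mem_F_iff {n : ℕ} (π : Equiv.Perm (Fin n)) (i : Fin (n + 1)) :
    insertMax π i ∈ F (n + 1) ↔ π ∈ F n ∧
      (∀ a b : Fin n, (i : ℕ) ≤ a → a < b → π a < π b) ∧
      (∀ a b c : Fin n, a < b → b < c → (c : ℕ) < i → π b < π c → π c < π a → False) ∧
      (∀ j k : Fin n, (j : ℕ) + 1 = i → (i : ℕ) ≤ k → (π j : ℕ) ≠ π k + 1) := by
  rw [mem_F_iff, mem_F_iff, isFishburn_iff, isFishburn_iff, not_contains_321_iff,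
    not_contains_321_iff, not_contains_3124_iff, not_contains_3124_iff]
  have hs := insertMax_self π i
  have hv := insertMax_succAbove π i
  have hc : ∀ a : Fin (n + 1), a = i ∨ ∃ j, a = i.succAbove j := fun a =>
    Fin.eq_self_or_eq_succAbove i a
  have hsv := succAbove_val i
  have hlt : ∀ a b : Fin n, i.succAbove a < i.succAbove b ↔ a < b := by simp
  generalize insertMax π i = τ at *
  constructor
  · rintro ⟨hF, h3, h4⟩
    refine ⟨⟨?_, ?_, ?_⟩, ?_, ?_, ?_⟩
    · intro j j' k hj hk he hl
      by_cases hi : (i : ℕ) = j'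
      · refine hF (i.succAbove j) i (i.succAbove k) ?_ ?_ ?_ ?_
        · rw [hsv]; split_ifs <;> omega
        · rw [Fin.lt_def, hsv]; split_ifs <;> omega
        · simpa [hv] using he
        · rw [hv, hs]; exact Fin.castSucc_lt_last _
      · refine hF (i.succAbove j) (i.succAbove j') (i.succAbove k) ?_ ?_ ?_ ?_
        · rw [hsv, hsv]; split_ifs <;> omega
        · simpa using hk
        · simpa [hv] using he
        · simpa [hv] using hl
    · intro a b c h1 h2 h5 h6
      exact h3 (i.succAbove a) (i.succAbove b) (i.succAbove c) (by simpa) (by simpa)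
        (by simpa [hv]) (by simpa [hv])
    · intro a b c d h1 h2 h3 h5 h6 h7
      exact h4 (i.succAbove a) (i.succAbove b) (i.succAbove c) (i.succAbove d) (by simpa)
        (by simpa) (by simpa) (by simpa [hv]) (by simpa [hv]) (by simpa [hv])
    · intro a b h1 h2
      by_contra h
      have hne : π a ≠ π b := fun e => h2.ne (π.injective e)
      refine h3 i (i.succAbove a) (i.succAbove b) ?_ (by simpa) ?_ ?_
      · rw [Fin.lt_def, hsv]; split_ifs <;> omega
      · simp only [hv, Fin.castSucc_lt_castSucc_iff]; exact lt_of_le_of_ne (not_lt.1 h) hne.symm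
      · rw [hv, hs]; exact Fin.castSucc_lt_last _
    · intro a b c h1 h2 h3 h5 h6
      refine h4 (i.succAbove a) (i.succAbove b) (i.succAbove c) i (by simpa)
        (by simpa) ?_ (by simpa [hv]) (by simpa [hv]) ?_
      · rw [Fin.lt_def, hsv]; split_ifs; omega
      · rw [hv, hs]; exact Fin.castSucc_lt_last _
    · intro j k h1 h2 h5
      refine hF (i.succAbove j) i (i.succAbove k) ?_ ?_ ?_ ?_
      · rw [hsv]; split_ifs <;> omega
      · rw [Fin.lt_def, hsv]; split_ifs <;> omega
      · simpa [hv] using h5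
      · rw [hv, hs]; exact Fin.castSucc_lt_last _
  · rintro ⟨⟨hF, h3, h4⟩, g1, g2, g3⟩
    have hlast : ∀ a : Fin (n + 1), ¬ Fin.last n < a := fun a => not_lt.2 (Fin.le_last a)
    refine ⟨?_, ?_, ?_⟩
    · intro j j' k hj hk he hl
      obtain rfl | ⟨j, rfl⟩ := hc j
      · rw [hs] at hl; exact hlast _ hl
      obtain rfl | ⟨k, rfl⟩ := hc k
      · rw [hs, hv] at he; simp at he; omega
      have hk' := hk
      rw [Fin.lt_def] at hk'
      simp only [hv, Fin.val_castSucc] at he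
      obtain rfl | ⟨j', rfl⟩ := hc j'
      · rw [hsv] at hj hk'
        refine g3 j k ?_ ?_ he <;> split_ifs at * <;> omega
      · simp only [hv, Fin.castSucc_lt_castSucc_iff, hlt] at hl hk
        by_cases h : (j' : ℕ) = j + 1
        · exact hF j j' k h hk he hl
        · rw [hsv, hsv] at hj
          split_ifs at hj <;> omega
    · intro a b c h1 h2 h5 h6
      obtain rfl | ⟨c, rfl⟩ := hc c
      · rw [hs] at h5; exact hlast _ h5
      obtain rfl | ⟨b, rfl⟩ := hc b
      · rw [hs] at h6; exact hlast _ h6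
      simp only [hv, Fin.castSucc_lt_castSucc_iff, hlt] at h2 h5
      obtain rfl | ⟨a, rfl⟩ := hc a
      · rw [Fin.lt_def, hsv] at h1
        refine absurd (g1 b c ?_ h2) (not_lt.2 h5.le)
        split_ifs at h1 <;> omega
      · simp only [hv, Fin.castSucc_lt_castSucc_iff, hlt] at h1 h6
        exact h3 a b c h1 h2 h5 h6
    · intro a b c d h1 h2 h3 h5 h6 h7
      obtain rfl | ⟨a, rfl⟩ := hc a
      · rw [hs] at h7; exact hlast _ h7
      obtain rfl | ⟨b, rfl⟩ := hc b
      · rw [hs] at h5; exact hlast _ h5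
      obtain rfl | ⟨c, rfl⟩ := hc c
      · rw [hs] at h6; exact hlast _ h6
      simp only [hv, Fin.castSucc_lt_castSucc_iff, hlt] at h1 h2 h5 h6
      obtain rfl | ⟨d, rfl⟩ := hc d
      · rw [Fin.lt_def, hsv] at h3
        refine g2 a b c h1 h2 ?_ h5 h6
        split_ifs at h3 <;> omega
      · simp only [hv, Fin.castSucc_lt_castSucc_iff, hlt] at h3 h7
        exact h4 a b c d h1 h2 h3 h5 h6 h7

theorem ltrMax_insertMax {n : ℕ} (π : Equiv.Perm (Fin n)) (i : Fin (n + 1)) :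
    ltrMax (insertMax π i) = (Finset.univ.filter fun j : Fin n =>
      (j : ℕ) < i ∧ ∀ a : Fin n, a < j → π a < π j).card + 1 := by
  have hs := insertMax_self π i
  have hv := insertMax_succAbove π i
  have hsv := succAbove_val i
  unfold ltrMax
  rw [Finset.card_filter, Finset.card_filter, Fin.sum_univ_succAbove _ i, if_pos, add_comm]
  · congr 1
    refine Finset.sum_congr rfl fun j _ => if_congr ?_ rfl rfl
    constructor
    · intro h
      refine ⟨?_, fun a ha => by simpa [hv] using h (i.succAbove a) (by simpa)⟩
      by_contra hj
      have := h i (by rw [Fin.lt_def, hsv]; split_ifs; omega)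
      rw [hs] at this
      exact absurd this (not_lt.2 (Fin.le_last _))
    · rintro ⟨hj, h⟩ a ha
      obtain rfl | ⟨a, rfl⟩ := Fin.eq_self_or_eq_succAbove i a
      · rw [Fin.lt_def, hsv] at ha
        split_ifs at ha; omega
      · simp only [hv, Fin.castSucc_lt_castSucc_iff]
        exact h a (by simpa using ha)
  · intro a ha
    obtain ⟨j, rfl⟩ := (Fin.eq_self_or_eq_succAbove i a).resolve_left ha.ne
    rw [hv, hs]; exact Fin.castSucc_lt_last _

/-! ### Inversions in Fishburn permutations -/

theorem val_ne {n : ℕ} (π : Equiv.Perm (Fin n)) {a b : Fin n} (h : a ≠ b) :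
    (π a : ℕ) ≠ π b := fun e => h (π.injective (Fin.ext e))

/-- In a Fishburn permutation, the smallest entry that is to the left of position `b` and larger
than `π b` is followed directly by `π b` or by an entry smaller than `π b`. -/
theorem IsFishburn.exists_min_inversion {n : ℕ} {π : Equiv.Perm (Fin n)} (hF : IsFishburn π)
    {a b : Fin n} (hab : a < b) (hπ : π b < π a) :
    ∃ x : Fin n, x < b ∧ π b < π x ∧ (∀ y, y < b → π b < π y → π x ≤ π y) ∧
      (∃ k, b ≤ k ∧ (π x : ℕ) = π k + 1) ∧
      ((x : ℕ) + 1 = b ∨ ∃ y, x < y ∧ y < b ∧ π y < π b) := by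
  rw [isFishburn_iff] at hF
  obtain ⟨x, hx, hmin⟩ := Finset.exists_min_image
    (Finset.univ.filter fun x : Fin n => x < b ∧ π b < π x) π ⟨a, by simp [hab, hπ]⟩
  simp only [Finset.mem_filter, Finset.mem_univ, true_and, and_imp] at hx hmin
  obtain ⟨hxb, hx⟩ := hx
  -- The value one below `π x` cannot occur before b: it would contradict minimality, being still
  -- above `π b` or equal to it.
  have hk : ∃ k, b ≤ k ∧ (π x : ℕ) = π k + 1 := by
    have hx' := Fin.lt_def.1 hx
    obtain ⟨k, hk⟩ := π.surjective ⟨(π x : ℕ) - 1, by omega⟩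
    have hk' : (π k : ℕ) = π x - 1 := by rw [hk]
    refine ⟨k, ?_, by omega⟩
    by_contra hkb
    have hne := val_ne π (ne_of_lt (not_le.1 hkb))
    have := hmin k (not_le.1 hkb) (by rw [Fin.lt_def]; omega)
    rw [Fin.le_def] at this
    omega
  refine ⟨x, hxb, hx, hmin, hk, ?_⟩
  obtain ⟨k, hbk, hk⟩ := hk
  by_cases h : (x : ℕ) + 1 = b
  · exact Or.inl h
  right
  have hxb' := Fin.lt_def.1 hxb
  obtain ⟨y, hy⟩ : ∃ y : Fin n, (y : ℕ) = x + 1 := ⟨⟨x + 1, by omega⟩, rfl⟩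
  have hxy : x < y := by rw [Fin.lt_def]; omega
  have hyb : y < b := by rw [Fin.lt_def]; omega
  refine ⟨y, hxy, hyb, ?_⟩
  by_contra hlt
  have hne := val_ne π hyb.ne
  have h2 := hmin y hyb (by rw [Fin.lt_def] at *; omega)
  have hne' := val_ne π hxy.ne
  exact hF x y k hy (lt_of_lt_of_le hyb hbk) hk (by rw [Fin.lt_def, Fin.le_def] at *; omega)

/-! ### Active sites -/

theorem insertMax_mem_F_iff_of_num {n k : ℕ} {π : Equiv.Perm (Fin n)} (hπ : π ∈ F n)
    (hl : HasLabel π (.num k)) (i : Fin (n + 1)) :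
    insertMax π i ∈ F (n + 1) ↔ n + 1 ≤ (i : ℕ) + k := by
  obtain ⟨hk2, hkn, h312, hfix, hdesc⟩ := hl
  rw [not_contains_312_iff] at h312
  rw [insertMax_mem_F_iff]
  constructor
  · rintro ⟨-, g1, -, g3⟩
    by_contra hi
    -- Position b is just before the fixed suffix. Its entry is too small and all later positions
    -- are fixed, so the value b lies further left, giving an inversion. A site at or before b then
    -- breaks the increasing or the Fishburn condition.
    have hb : ∃ b : Fin n, (b : ℕ) + k = n := ⟨⟨n - k, by omega⟩, by simp; omega⟩
    obtain ⟨b, hb⟩ := hb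
    have hbd := hdesc b hb
    obtain ⟨a, ha⟩ := π.surjective b
    have hab : a < b := by
      by_contra hab
      rcases (not_lt.1 hab).eq_or_lt with h | h
      · subst h; rw [ha] at hbd; omega
      · have := hfix a (by rw [Fin.lt_def] at h; omega)
        rw [ha] at this; exact h.ne this
    obtain ⟨x, hxb, hx, -, ⟨m, hbm, hm⟩, h | ⟨y, hxy, hyb, hy⟩⟩ :=
      ((mem_F_iff π).1 hπ).1.exists_min_inversion hab (by rw [Fin.lt_def, ha]; omega)
    · by_cases hix : (i : ℕ) ≤ x
      · exact absurd (g1 x b hix hxb) (not_lt.2 hx.le)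
      · exact g3 x m (by omega) (by rw [Fin.le_def] at hbm; omega) hm
    · exact h312 x y b hxy hyb hy hx
  · intro hi
    refine ⟨hπ, ?_, fun a b c h1 h2 _ => h312 a b c h1 h2, ?_⟩
    · intro a b ha hab
      rw [hfix a (by omega), hfix b (by rw [Fin.lt_def] at hab; omega)]
      exact hab
    · intro j m hj hm
      rw [hfix m (by omega)]
      by_cases h : n + 1 ≤ (j : ℕ) + k
      · rw [hfix j h]; omega
      · have := hdesc j (by omega)
        omega

theorem exists_num_of_last {n : ℕ} {π : Equiv.Perm (Fin n)} (hπ : π ∈ F n) {p : Fin n}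
    (hp : (p : ℕ) + 1 = n) (hpp : π p = p) : ∃ k, HasLabel π (.num k) := by
  classical
  -- The least m starting a suffix of fixed points determines the label k = n + 1 - m; m = 0 is the
  -- identity.
  have hex : ∃ m : ℕ, m < n ∧ ∀ i : Fin n, m ≤ i → π i = i := by
    refine ⟨p, p.2, fun i hi => ?_⟩
    obtain rfl : i = p := Fin.ext (by omega)
    exact hpp
  obtain ⟨hm, hfix⟩ := Nat.find_spec hex
  have hmin := fun m => @Nat.find_min _ _ hex m
  generalize Nat.find hex = m at hm hfix hmin
  refine ⟨n + 1 - m, by omega, by omega, ?_, fun i hi => hfix i (by omega), ?_⟩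
  · have h4 := ((mem_F_iff π).1 hπ).2.2
    rw [not_contains_3124_iff] at h4
    rw [not_contains_312_iff]
    intro a b c h1 h2 h3 h5
    have hne : c ≠ p := by
      rintro rfl
      rw [hpp, Fin.lt_def] at h5; omega
    have hne' := val_ne π (a := a) (b := p) (by rintro rfl; rw [Fin.lt_def] at *; omega)
    rw [hpp] at hne'
    refine h4 a b c p h1 h2 ?_ h3 h5 ?_
    · rw [Fin.lt_def]; have := Fin.val_ne_of_ne hne; omega
    · rw [hpp, Fin.lt_def]; omega
  · intro i hi
    have hi' : (π i : ℕ) ≤ i := by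
      by_contra h
      have := hfix (π i) (by omega)
      rw [π.injective this] at h
      exact h le_rfl
    have hne : (π i : ℕ) ≠ i := by
      intro he
      refine hmin i (by omega) ⟨i.2, fun j hj => ?_⟩
      rcases hj.eq_or_lt with h | h
      · obtain rfl := Fin.ext h
        exact Fin.ext he
      · exact hfix j (by omega)
    omega

/-- The minimal larger entry before b is not the maximum, because the second largest entry also
precedes b. Hence it is not adjacent to b, and a smaller entry separates them. -/
theorem exists_312_of_inversion {n : ℕ} {π : Equiv.Perm (Fin n)} (hπ : π ∈ F n)
    {p q b : Fin n} (hp : (π p : ℕ) + 1 = n) (hq : (π q : ℕ) + 2 = n) (hqp : q < p)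
    (hb : (p : ℕ) + 1 = b) : ∃ x y, x < y ∧ y < b ∧ π y < π b ∧ π b < π x := by
  have hpb : p < b := by rw [Fin.lt_def]; omega
  have h1 := val_ne π hpb.ne
  have h2 := val_ne π (hqp.trans hpb).ne
  obtain ⟨x, hxb, hx, hmin, -, h | ⟨y, hxy, hyb, hy⟩⟩ :=
    ((mem_F_iff π).1 hπ).1.exists_min_inversion hpb (by rw [Fin.lt_def]; omega)
  · obtain rfl : x = p := Fin.ext (by omega)
    have := hmin q (hqp.trans hpb) (by rw [Fin.lt_def]; omega)
    rw [Fin.le_def] at this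
    omega
  · exact ⟨x, y, hxy, hyb, hy, hx⟩

theorem increasing_after_max {n : ℕ} {π : Equiv.Perm (Fin n)} (hπ : π ∈ F n)
    {p a b : Fin n} (hp : (π p : ℕ) + 1 = n) (hpa : p < a) (hab : a < b) : π a < π b := by
  have h3 := ((mem_F_iff π).1 hπ).2.1
  rw [not_contains_321_iff] at h3
  have h1 := val_ne π hpa.ne
  have h2 := val_ne π hab.ne
  by_contra h
  exact h3 p a b hpa hab (by rw [Fin.lt_def] at *; omega) (by rw [Fin.lt_def]; omega)

theorem no_312_before_max {n : ℕ} {π : Equiv.Perm (Fin n)} (hπ : π ∈ F n)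
    {p a b c : Fin n} (hp : (π p : ℕ) + 1 = n) (hab : a < b) (hbc : b < c) (hcp : c ≤ p)
    (h1 : π b < π c) (h2 : π c < π a) : False := by
  have h4 := ((mem_F_iff π).1 hπ).2.2
  rw [not_contains_3124_iff] at h4
  have h5 := val_ne π (hab.trans (hbc.trans_le hcp)).ne
  rcases hcp.eq_or_lt with rfl | h
  · rw [Fin.lt_def] at h2; omega
  · exact h4 a b c p hab hbc h h1 h2 (by rw [Fin.lt_def]; omega)

/-- Sites up to the old maximum leave a descent behind them; sites beyond the next entry have a 312
before them. Directly after the old maximum, the Fishburn condition could fail only if the second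
largest entry were to the right. -/
theorem insertMax_mem_F_iff_of_lt {n : ℕ} {π : Equiv.Perm (Fin n)} (hπ : π ∈ F n)
    {p q : Fin n} (hp : (π p : ℕ) + 1 = n) (hq : (π q : ℕ) + 2 = n) (hqp : q < p)
    (hpn : (p : ℕ) + 1 < n) (i : Fin (n + 1)) :
    insertMax π i ∈ F (n + 1) ↔ (i : ℕ) = p + 1 := by
  rw [insertMax_mem_F_iff]
  have hb : ∃ b : Fin n, (p : ℕ) + 1 = b := ⟨⟨p + 1, hpn⟩, rfl⟩
  obtain ⟨b, hb⟩ := hb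
  have hpb : p < b := by rw [Fin.lt_def]; omega
  constructor
  · rintro ⟨-, g1, g2, -⟩
    have h1 : ¬ (i : ℕ) ≤ p := fun h => by
      have := g1 p b h hpb
      rw [Fin.lt_def] at this; omega
    by_contra h2
    obtain ⟨x, y, hxy, hyb, hy, hx⟩ := exists_312_of_inversion hπ hp hq hqp hb
    exact g2 x y b hxy hyb (by omega) hy hx
  · intro hi
    refine ⟨hπ, fun a c ha hac => increasing_after_max hπ hp (by rw [Fin.lt_def]; omega) hac,
      fun a d c h1 h2 h3 => no_312_before_max hπ hp h1 h2 (by rw [Fin.le_def]; omega), ?_⟩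
    intro j k hj hk he
    obtain rfl : j = p := Fin.ext (by omega)
    obtain rfl : k = q := π.injective (Fin.ext (by omega))
    rw [Fin.lt_def] at hqp; omega

/-- The site just after the old maximum is now excluded by Fishburn, since the second largest entry
lies to the right. Any site beyond the next one has a 312 before it, formed by the maximum and its
two successors. -/
theorem insertMax_mem_F_iff_of_gt {n : ℕ} {π : Equiv.Perm (Fin n)} (hπ : π ∈ F n)
    {p q : Fin n} (hp : (π p : ℕ) + 1 = n) (hq : (π q : ℕ) + 2 = n) (hpq : p < q)
    (i : Fin (n + 1)) :
    insertMax π i ∈ F (n + 1) ↔ (i : ℕ) = p + 2 := by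
  rw [insertMax_mem_F_iff]
  have hpq' := Fin.lt_def.1 hpq
  have hb : ∃ b : Fin n, (p : ℕ) + 1 = b := ⟨⟨p + 1, by omega⟩, rfl⟩
  obtain ⟨b, hb⟩ := hb
  have hpb : p < b := by rw [Fin.lt_def]; omega
  have hbp := val_ne π hpb.ne
  constructor
  · rintro ⟨-, g1, g2, g3⟩
    have h1 : ¬ (i : ℕ) ≤ p := fun h => by
      have := g1 p b h hpb
      rw [Fin.lt_def] at this; omega
    have h2 : (i : ℕ) ≠ p + 1 := fun h => g3 p q (by omega) (by omega) (by omega)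
    by_contra h3
    have hc : ∃ c : Fin n, (p : ℕ) + 2 = c := ⟨⟨p + 2, by omega⟩, rfl⟩
    obtain ⟨c, hc⟩ := hc
    have hbc : b < c := by rw [Fin.lt_def]; omega
    have hcp := val_ne π (hpb.trans hbc).ne
    exact g2 p b c hpb hbc (by omega) (increasing_after_max hπ hp hpb hbc)
      (by rw [Fin.lt_def]; omega)
  · intro hi
    refine ⟨hπ, fun a c ha hac => increasing_after_max hπ hp (by rw [Fin.lt_def]; omega) hac,
      ?_, ?_⟩
    · intro a d c h1 h2 h3 h5 h6
      by_cases hcp : c ≤ p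
      · exact no_312_before_max hπ hp h1 h2 hcp h5 h6
      obtain rfl : c = b := Fin.ext (by rw [Fin.le_def] at hcp; omega)
      have hap : a ≠ p := by rintro rfl; rw [Fin.lt_def] at *; omega
      have haq : a ≠ q := by rintro rfl; rw [Fin.lt_def] at *; omega
      have e1 := val_ne π hap
      have e2 := val_ne π haq
      have hcq : c < q := by
        rcases lt_trichotomy c q with h | h | h
        · exact h
        · subst h; rw [Fin.lt_def] at h6; omega
        · rw [Fin.lt_def] at h; omega
      -- The second largest entry, at q, completes the 312 to a 3124.
      have h4 := ((mem_F_iff π).1 hπ).2.2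
      rw [not_contains_3124_iff] at h4
      exact h4 a d c q h1 h2 hcq h5 h6 (by rw [Fin.lt_def]; omega)
    · intro j k hj hk he
      obtain rfl : j = b := Fin.ext (by omega)
      have := increasing_after_max hπ hp hpb (show j < k by rw [Fin.lt_def]; omega)
      rw [Fin.lt_def] at this; omega

/-! ### Existence and uniqueness of labels -/

theorem exists_positions {n : ℕ} (π : Equiv.Perm (Fin n)) (hn : 2 ≤ n) :
    ∃ p q : Fin n, (π p : ℕ) + 1 = n ∧ (π q : ℕ) + 2 = n := by
  obtain ⟨p, hp⟩ := π.surjective ⟨n - 1, by omega⟩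
  obtain ⟨q, hq⟩ := π.surjective ⟨n - 2, by omega⟩
  exact ⟨p, q, by rw [hp]; simp; omega, by rw [hq]; simp; omega⟩

theorem exists_hasLabel {n : ℕ} {π : Equiv.Perm (Fin n)} (hπ : π ∈ F n) :
    ∃ l, HasLabel π l := by
  rcases Nat.eq_zero_or_pos n with h0 | h0
  · exact ⟨.oneA, Or.inl h0⟩
  obtain ⟨p, hp⟩ := π.surjective ⟨n - 1, by omega⟩
  have hp : (π p : ℕ) + 1 = n := by rw [hp]; simp; omega
  by_cases hpn : (p : ℕ) + 1 = n
  · obtain ⟨k, hk⟩ := exists_num_of_last hπ hpn (Fin.ext (by omega))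
    exact ⟨_, hk⟩
  obtain ⟨q, hq⟩ := π.surjective ⟨n - 2, by omega⟩
  have hq : (π q : ℕ) + 2 = n := by rw [hq]; simp; omega
  have hb : ∃ b : Fin n, (p : ℕ) + 1 = b := ⟨⟨p + 1, by omega⟩, rfl⟩
  obtain ⟨b, hb⟩ := hb
  have hpb : p < b := by rw [Fin.lt_def]; omega
  rcases lt_trichotomy p q with h | h | h
  · by_cases hpn' : (p : ℕ) + 2 = n
    · refine ⟨.oneA, Or.inr ⟨p, q, hpn', ?_, hp, hq⟩⟩
      rw [Fin.lt_def] at h; omega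
    · have hc : ∃ c : Fin n, (p : ℕ) + 2 = c := ⟨⟨p + 2, by omega⟩, rfl⟩
      obtain ⟨c, hc⟩ := hc
      have hbc : b < c := by rw [Fin.lt_def]; omega
      have hcp := val_ne π (hpb.trans hbc).ne
      exact ⟨.oneB, (contains_312_iff π).2 ⟨p, b, c, hpb, hbc,
        increasing_after_max hπ hp hpb hbc, by rw [Fin.lt_def]; omega⟩⟩
  · subst h; omega
  · obtain ⟨x, y, hxy, hyb, hy, hx⟩ := exists_312_of_inversion hπ hp hq h hb
    exact ⟨.oneB, (contains_312_iff π).2 ⟨x, y, b, hxy, hyb, hy, hx⟩⟩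

/-- A 312 ending in the last entry would need the maximum as its 3, but the two are adjacent,
leaving no room for the 1. -/
theorem not_contains_312_of_oneA {n : ℕ} {π : Equiv.Perm (Fin n)} (hπ : π ∈ F n)
    (hl : HasLabel π .oneA) : ¬ Contains ![3, 1, 2] π := by
  rw [not_contains_312_iff]
  rcases hl with rfl | ⟨i, j, hi, hj, hpi, hpj⟩
  · exact fun a => a.elim0
  intro a b c h1 h2 h3 h4
  by_cases hc : c ≤ i
  · exact no_312_before_max hπ hpi h1 h2 hc h3 h4
  obtain rfl : c = j := Fin.ext (by rw [Fin.le_def] at hc; omega)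
  have := val_ne π (a := a) (b := i) (by rintro rfl; rw [Fin.lt_def] at *; omega)
  rw [Fin.lt_def] at h4; omega

theorem hasLabel_num_unique {n k m : ℕ} {π : Equiv.Perm (Fin n)}
    (hk : HasLabel π (.num k)) (hm : HasLabel π (.num m)) : m ≤ k := by
  obtain ⟨hk2, hkn, -, -, hk⟩ := hk
  obtain ⟨hm2, hmn, -, hm, -⟩ := hm
  by_contra h
  have h1 := hk ⟨n - k, by omega⟩ (by simp; omega)
  rw [hm ⟨n - k, by omega⟩ (by simp; omega)] at h1
  simp at h1

theorem not_num_of_oneA {n k : ℕ} {π : Equiv.Perm (Fin n)}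
    (hl : HasLabel π .oneA) (hk : HasLabel π (.num k)) : False := by
  obtain ⟨hk2, hkn, -, hfix, -⟩ := hk
  rcases hl with rfl | ⟨i, j, hi, hj, hpi, hpj⟩
  · omega
  · rw [hfix j (by omega)] at hpj; omega

theorem hasLabel_unique {n : ℕ} {π : Equiv.Perm (Fin n)} (hπ : π ∈ F n) {l l' : Label}
    (h : HasLabel π l) (h' : HasLabel π l') : l = l' := by
  match l, l', h, h' with
  | .oneA, .oneA, _, _ => rfl
  | .oneA, .oneB, h, h' => exact absurd h' (not_contains_312_of_oneA hπ h)
  | .oneA, .num k, h, h' => exact (not_num_of_oneA h h').elim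
  | .oneB, .oneA, h, h' => exact absurd h (not_contains_312_of_oneA hπ h')
  | .oneB, .oneB, _, _ => rfl
  | .oneB, .num k, h, h' => exact absurd h h'.2.2.1
  | .num k, .oneA, h, h' => exact (not_num_of_oneA h' h).elim
  | .num k, .oneB, h, h' => exact absurd h' h.2.2.1
  | .num k, .num m, h, h' =>
    rw [le_antisymm (hasLabel_num_unique h' h) (hasLabel_num_unique h h')]

open Classical in
/-- The label of a permutation. -/
noncomputable def label (n : ℕ) (π : Equiv.Perm (Fin n)) : Label :=
  if h : ∃ l, HasLabel π l then h.choose else .oneA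

theorem hasLabel_label {n : ℕ} {π : Equiv.Perm (Fin n)} (hπ : π ∈ F n) :
    HasLabel π (label n π) := by
  rw [label, dif_pos (exists_hasLabel hπ)]
  exact (exists_hasLabel hπ).choose_spec

theorem hasLabel_iff {n : ℕ} {π : Equiv.Perm (Fin n)} (hπ : π ∈ F n) (l : Label) :
    HasLabel π l ↔ label n π = l :=
  ⟨fun h => hasLabel_unique hπ (hasLabel_label hπ) h, fun h => h ▸ hasLabel_label hπ⟩

/-! ### Labels of the children -/

theorem insertMax_last_castSucc {n : ℕ} (π : Equiv.Perm (Fin n)) (j : Fin n) :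
    insertMax π (Fin.last n) j.castSucc = (π j).castSucc := by
  simpa using insertMax_succAbove π (Fin.last n) j

theorem contains_312_insertMax {n : ℕ} {π : Equiv.Perm (Fin n)} (h : Contains ![3, 1, 2] π)
    (i : Fin (n + 1)) : Contains ![3, 1, 2] (insertMax π i) := by
  rw [contains_312_iff] at *
  obtain ⟨a, b, c, h1, h2, h3, h4⟩ := h
  exact ⟨i.succAbove a, i.succAbove b, i.succAbove c, by simpa, by simpa,
    by simpa [insertMax_succAbove], by simpa [insertMax_succAbove]⟩

theorem not_contains_312_insertMax_last {n : ℕ} {π : Equiv.Perm (Fin n)}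
    (h : insertMax π (Fin.last n) ∈ F (n + 1)) :
    ¬ Contains ![3, 1, 2] (insertMax π (Fin.last n)) := by
  rw [not_contains_312_iff]
  exact fun a b c h1 h2 => no_312_before_max h (by rw [insertMax_self]; rfl) h1 h2 (Fin.le_last c)

theorem hasLabel_insertMax_last_of_num {n k : ℕ} {π : Equiv.Perm (Fin n)}
    (hl : HasLabel π (.num k)) (h : insertMax π (Fin.last n) ∈ F (n + 1)) :
    HasLabel (insertMax π (Fin.last n)) (.num (k + 1)) := by
  obtain ⟨hk2, hkn, -, hfix, hdesc⟩ := hl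
  refine ⟨by omega, by omega, not_contains_312_insertMax_last h, fun i hi => ?_, fun i hi => ?_⟩
  · induction i using Fin.lastCases with
    | last => rw [insertMax_self]
    | cast i =>
      rw [Fin.val_castSucc] at hi
      rw [insertMax_last_castSucc, hfix i (by omega)]
  · induction i using Fin.lastCases with
    | last => rw [Fin.val_last] at hi; omega
    | cast i =>
      rw [Fin.val_castSucc] at hi
      rw [insertMax_last_castSucc, Fin.val_castSucc]
      have := hdesc i (by omega)
      omega

theorem hasLabel_insertMax_last_of_oneA {n : ℕ} {π : Equiv.Perm (Fin n)}
    (hl : HasLabel π .oneA) (h : insertMax π (Fin.last n) ∈ F (n + 1)) :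
    HasLabel (insertMax π (Fin.last n)) (.num 2) := by
  refine ⟨le_rfl, by omega, not_contains_312_insertMax_last h, fun i hi => ?_, fun i hi => ?_⟩
  · obtain rfl : i = Fin.last n := Fin.ext (by rw [Fin.val_last]; omega)
    rw [insertMax_self]
  · induction i using Fin.lastCases with
    | last => rw [Fin.val_last] at hi; omega
    | cast i =>
      rw [Fin.val_castSucc] at hi
      rw [insertMax_last_castSucc, Fin.val_castSucc]
      rcases hl with rfl | ⟨a, j, -, hj, -, hpj⟩
      · exact i.elim0
      · obtain rfl : i = j := Fin.ext (by omega)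
        omega

theorem hasLabel_insertMax_of_num_oneA {n k : ℕ} {π : Equiv.Perm (Fin n)}
    (hl : HasLabel π (.num k)) {i : Fin (n + 1)} (hi : (i : ℕ) + 1 = n) :
    HasLabel (insertMax π i) .oneA := by
  obtain ⟨hk2, hkn, -, hfix, -⟩ := hl
  right
  have hm : ∃ m : Fin n, (m : ℕ) + 1 = n := ⟨⟨n - 1, by omega⟩, by simp; omega⟩
  obtain ⟨m, hm⟩ := hm
  refine ⟨i, i.succAbove m, by omega, ?_, by rw [insertMax_self]; rfl, ?_⟩
  · rw [succAbove_val]; split_ifs <;> omega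
  · rw [insertMax_succAbove, Fin.val_castSucc, hfix m (by omega)]; omega

theorem hasLabel_insertMax_of_num_oneB {n k : ℕ} {π : Equiv.Perm (Fin n)}
    (hl : HasLabel π (.num k)) {i : Fin (n + 1)} (hik : n + 1 ≤ (i : ℕ) + k)
    (hi : (i : ℕ) + 2 ≤ n) : HasLabel (insertMax π i) .oneB := by
  obtain ⟨hk2, hkn, -, hfix, -⟩ := hl
  have hm : ∃ m : Fin n, (m : ℕ) + 1 = n := ⟨⟨n - 1, by omega⟩, by simp; omega⟩
  obtain ⟨m, hm⟩ := hm
  have hb : ∃ b : Fin n, (b : ℕ) + 2 = n := ⟨⟨n - 2, by omega⟩, by simp; omega⟩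
  obtain ⟨b, hb⟩ := hb
  refine (contains_312_iff _).2 ⟨i, i.succAbove b, i.succAbove m, ?_, ?_, ?_, ?_⟩
  · rw [Fin.lt_def, succAbove_val]; split_ifs <;> omega
  · rw [Fin.succAbove_lt_succAbove_iff, Fin.lt_def]; omega
  · rw [insertMax_succAbove, insertMax_succAbove, hfix m (by omega), hfix b (by omega),
      Fin.castSucc_lt_castSucc_iff, Fin.lt_def]
    omega
  · rw [insertMax_succAbove, insertMax_self]; exact Fin.castSucc_lt_last _

/-! ### Left-to-right maxima of the children -/

theorem ltrMax_insertMax_of_forall {n : ℕ} (π : Equiv.Perm (Fin n)) (i : Fin (n + 1))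
    (h : ∀ j : Fin n, (∀ a : Fin n, a < j → π a < π j) → (j : ℕ) < i) :
    ltrMax (insertMax π i) = ltrMax π + 1 := by
  rw [ltrMax_insertMax, ltrMax]
  congr 2
  ext j
  simp only [Finset.mem_filter, Finset.mem_univ, true_and]
  exact ⟨fun hj => hj.2, fun hj => ⟨h j hj, hj⟩⟩

theorem ltrMax_insertMax_last {n : ℕ} (π : Equiv.Perm (Fin n)) :
    ltrMax (insertMax π (Fin.last n)) = ltrMax π + 1 :=
  ltrMax_insertMax_of_forall π _ fun j _ => j.2

theorem ltrMax_insertMax_of_max_lt {n : ℕ} {π : Equiv.Perm (Fin n)} {p : Fin n}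
    (hp : (π p : ℕ) + 1 = n) {i : Fin (n + 1)} (hi : (p : ℕ) < i) :
    ltrMax (insertMax π i) = ltrMax π + 1 := by
  refine ltrMax_insertMax_of_forall π _ fun j hj => ?_
  by_contra h
  have := hj p (by rw [Fin.lt_def]; omega)
  rw [Fin.lt_def] at this
  omega

/-- The n - i entries after the site belong to the fixed suffix, so all were left-to-right maxima.
They lose that status, while the new maximum gains it. -/
theorem ltrMax_insertMax_of_num {n k : ℕ} {π : Equiv.Perm (Fin n)}
    (hl : HasLabel π (.num k)) {i : Fin (n + 1)} (hi : n + 1 ≤ (i : ℕ) + k) :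
    ltrMax (insertMax π i) + (n - i) = ltrMax π + 1 := by
  obtain ⟨-, -, -, hfix, -⟩ := hl
  have hc : (Finset.univ.filter fun j : Fin n => ¬ (j : ℕ) < i).card = n - i := by
    have h1 := Finset.card_filter_add_card_filter_not (s := (Finset.univ : Finset (Fin n)))
      (fun j : Fin n => (j : ℕ) < i)
    have h2 : (Finset.univ.filter fun j : Fin n => (j : ℕ) < i).card = i := by
      rw [Fin.card_filter_val_lt]; omega
    rw [Finset.card_univ, Fintype.card_fin] at h1
    omega
  rw [ltrMax_insertMax, ltrMax, ← hc, add_right_comm, ← Finset.card_union_of_disjoint]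
  · congr 2
    ext j
    simp only [Finset.mem_filter, Finset.mem_univ, true_and, Finset.mem_union]
    constructor
    · rintro (h | h)
      · exact h.2
      · intro a ha
        have hj := hfix j (by omega)
        rw [hj]
        by_contra hja
        rw [Fin.lt_def] at *
        have := hfix (π a) (by omega)
        rw [π.injective this] at hja
        exact hja ha
    · intro h
      by_cases hj : (j : ℕ) < i
      · exact Or.inl ⟨hj, h⟩
      · exact Or.inr hj
  · rw [Finset.disjoint_filter]
    intro j _ h1 h2
    exact h2 h1.1

/-! ### The succession rule refined by left-to-right maxima -/

/-- The succession rule for permutations labelled also by their number of left-to-right maxima. -/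
def stateRule : Label × ℕ → Multiset (Label × ℕ)
  | (.oneA, l) => {(.num 2, l + 1)}
  | (.oneB, l) => {(.oneB, l + 1)}
  -- Index j stands for the site with j + 2 entries after it, so the count is l + 1 - (j + 2).
  | (.num k, l) => (Multiset.range (k - 2)).map (fun j => (.oneB, l - 1 - j)) +
      {(.oneA, l), (.num (k + 1), l + 1)}

/-- The label of a permutation together with its number of left-to-right maxima. -/
noncomputable def state (n : ℕ) (π : Equiv.Perm (Fin n)) : Label × ℕ :=
  (label n π, ltrMax π)

theorem activeSites_eq_singleton {n : ℕ} {π : Equiv.Perm (Fin n)} {i : Fin (n + 1)}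
    (h : ∀ j : Fin (n + 1), insertMax π j ∈ F (n + 1) ↔ (j : ℕ) = i) :
    activeSites F π = {i} := by
  ext j
  simp [activeSites, h, Fin.ext_iff]

theorem activeSites_of_oneA {n : ℕ} {π : Equiv.Perm (Fin n)} (hπ : π ∈ F n)
    (hl : HasLabel π .oneA) : activeSites F π = {Fin.last n} := by
  apply activeSites_eq_singleton
  intro i
  rcases hl with rfl | ⟨p, q, hi, hj, hp, hq⟩
  · rw [insertMax_mem_F_iff]
    exact ⟨fun _ => by rw [Fin.val_last]; omega, fun _ => ⟨hπ, fun a => a.elim0, fun a => a.elim0,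
      fun a => a.elim0⟩⟩
  · rw [insertMax_mem_F_iff_of_gt hπ hp hq (by rw [Fin.lt_def]; omega), Fin.val_last, hi]

theorem activeSites_of_oneB {n : ℕ} {π : Equiv.Perm (Fin n)} (hπ : π ∈ F n)
    (hl : HasLabel π .oneB) : ∃ i, activeSites F π = {i} ∧
      ltrMax (insertMax π i) = ltrMax π + 1 := by
  have hn : 2 ≤ n := by
    obtain ⟨a, b, c, h1, h2, -⟩ := (contains_312_iff π).1 hl
    rw [Fin.lt_def] at h1 h2
    omega
  obtain ⟨p, q, hp, hq⟩ := exists_positions π hn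
  have hpn : (p : ℕ) + 1 < n := by
    by_contra h
    obtain ⟨a, b, c, h1, h2, h3, h4⟩ := (contains_312_iff π).1 hl
    exact no_312_before_max hπ hp h1 h2 (by rw [Fin.le_def]; omega) h3 h4
  rcases lt_trichotomy p q with h | h | h
  · have h' := Fin.lt_def.1 h
    refine ⟨⟨p + 2, by omega⟩, activeSites_eq_singleton (insertMax_mem_F_iff_of_gt hπ hp hq h),
      ltrMax_insertMax_of_max_lt hp (by simp)⟩
  · subst h; omega
  · refine ⟨⟨p + 1, by omega⟩,
      activeSites_eq_singleton (insertMax_mem_F_iff_of_lt hπ hp hq h hpn),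
      ltrMax_insertMax_of_max_lt hp (by simp)⟩

theorem activeSites_of_num {n k : ℕ} {π : Equiv.Perm (Fin n)} (hπ : π ∈ F n)
    (hl : HasLabel π (.num k)) :
    (activeSites F π).val = (Multiset.range k).map fun j => ⟨n - j, by omega⟩ := by
  have hk := hl.2.1
  rw [Multiset.Nodup.ext (Finset.nodup _)]
  · intro i
    simp only [activeSites, insertMax_mem_F_iff_of_num hπ hl, Finset.mem_val, Finset.mem_filter,
      Finset.mem_univ, true_and, Multiset.mem_map, Multiset.mem_range, Fin.ext_iff]
    exact ⟨fun h => ⟨n - i, by omega, by omega⟩, by rintro ⟨j, h1, h2⟩; omega⟩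
  · refine Multiset.Nodup.map_on (fun a ha b hb h => ?_) (Multiset.nodup_range k)
    simp only [Multiset.mem_range, Fin.mk.injEq] at *
    omega

theorem map_state_activeSites {n : ℕ} {π : Equiv.Perm (Fin n)} (hπ : π ∈ F n) :
    (activeSites F π).val.map (fun i => state (n + 1) (insertMax π i)) =
      stateRule (state n π) := by
  have hl := hasLabel_label hπ
  have hact : ∀ i, i ∈ activeSites F π → insertMax π i ∈ F (n + 1) := by simp [activeSites]
  rw [state]
  generalize label n π = l at hl
  match l, hl with
  | .oneA, hl =>
    have h := activeSites_of_oneA hπ hl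
    have hm := hact (Fin.last n) (by simp [h])
    rw [h, Finset.singleton_val, Multiset.map_singleton, stateRule, state,
      (hasLabel_iff hm _).1 (hasLabel_insertMax_last_of_oneA hl hm), ltrMax_insertMax_last]
  | .oneB, hl =>
    obtain ⟨i, h, hi⟩ := activeSites_of_oneB hπ hl
    have hm := hact i (by simp [h])
    rw [h, Finset.singleton_val, Multiset.map_singleton, stateRule, state,
      (hasLabel_iff hm .oneB).1 (contains_312_insertMax hl i), hi]
  | .num k, hl =>
    have h := activeSites_of_num hπ hl
    have hk := hl.1
    have hkn := hl.2.1
    have key : ∀ j, j < k → ∀ s : Label,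
        HasLabel (insertMax π (⟨n - j, by omega⟩ : Fin (n + 1))) s →
        state (n + 1) (insertMax π ⟨n - j, by omega⟩) = (s, ltrMax π + 1 - j) := by
      intro j hj s hs
      have hm := hact ⟨n - j, by omega⟩
        (by rw [← Finset.mem_val, h]; exact Multiset.mem_map_of_mem _ (Multiset.mem_range.2 hj))
      have hlt := ltrMax_insertMax_of_num hl (i := ⟨n - j, by omega⟩) (by simp; omega)
      rw [state, (hasLabel_iff hm s).1 hs]
      simp only [Prod.mk.injEq, true_and] at hlt ⊢
      omega
    have h0 := key 0 (by omega) (.num (k + 1)) (hasLabel_insertMax_last_of_num hl (hact _ (by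
      rw [← Finset.mem_val, h]; exact Multiset.mem_map.2 ⟨0, Multiset.mem_range.2 (by omega), rfl⟩)))
    have h1 := key 1 (by omega) .oneA (hasLabel_insertMax_of_num_oneA hl (by simp; omega))
    -- The two rightmost sites give the labels (k + 1) and (1a); the other k - 2 give (1b).
    rw [h, Multiset.map_map, stateRule, show k = 2 + (k - 2) by omega, Multiset.range_add,
      Multiset.map_add, add_comm, Multiset.map_map, show 2 + (k - 2) - 2 = k - 2 by omega]
    congr 1
    · refine Multiset.map_congr rfl fun j hj => ?_
      rw [Multiset.mem_range] at hj
      simp only [Function.comp_apply]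
      rw [key (2 + j) (by omega) .oneB
        (hasLabel_insertMax_of_num_oneB hl (by simp; omega) (by simp; omega))]
      rw [Prod.mk.injEq]
      exact ⟨rfl, by omega⟩
    · rw [show 2 + (k - 2) + 1 = k + 1 by omega]
      simp only [Multiset.range_succ, Multiset.range_zero, Multiset.map_cons, Multiset.map_zero,
        Function.comp_apply, h0, h1]
      rfl

/-! ### Weights and their recurrences -/

open Polynomial in
/-- The weight `t ^ ltrMax` of the permutations labelled (1a), and zero for the others. -/
noncomputable def weightA : Label × ℕ → ℤ[X]
  | (.oneA, l) => X ^ l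
  | _ => 0

open Polynomial in
/-- The weight `t ^ ltrMax` of the permutations labelled (1b), and zero for the others. -/
noncomputable def weightB : Label × ℕ → ℤ[X]
  | (.oneB, l) => X ^ l
  | _ => 0

open Polynomial in
/-- The weight `t ^ ltrMax` of the permutations labelled (k), and zero for the others. -/
noncomputable def weightK : Label × ℕ → ℤ[X]
  | (.num _, l) => X ^ l
  | _ => 0

open Polynomial in
/-- The total weight of the children labelled (1b) of the permutations labelled (k). -/
noncomputable def weightD : Label × ℕ → ℤ[X]
  | (.num k, l) => ∑ j ∈ Finset.range (k - 2), X ^ (l - 1 - j)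
  | _ => 0

theorem weight_add (s : Label × ℕ) :
    weightA s + weightB s + weightK s = Polynomial.X ^ s.2 := by
  match s with
  | (.oneA, l) => simp [weightA, weightB, weightK]
  | (.oneB, l) => simp [weightA, weightB, weightK]
  | (.num k, l) => simp [weightA, weightB, weightK]

theorem sum_weightA_stateRule (s : Label × ℕ) :
    ((stateRule s).map weightA).sum = weightK s := by
  match s with
  | (.oneA, l) => simp [stateRule, weightA, weightK]
  | (.oneB, l) => simp [stateRule, weightA, weightK]
  | (.num k, l) => simp [stateRule, weightA, weightK, Function.comp_def]

theorem sum_weightB_stateRule (s : Label × ℕ) :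
    ((stateRule s).map weightB).sum = Polynomial.X * weightB s + weightD s := by
  match s with
  | (.oneA, l) => simp [stateRule, weightB, weightD]
  | (.oneB, l) => simp [stateRule, weightB, weightD, pow_succ']
  | (.num k, l) => simp [stateRule, weightB, weightD, Function.comp_def, Finset.sum]

theorem sum_weightK_stateRule (s : Label × ℕ) :
    ((stateRule s).map weightK).sum = Polynomial.X * (weightA s + weightK s) := by
  match s with
  | (.oneA, l) => simp [stateRule, weightA, weightK, pow_succ']
  | (.oneB, l) => simp [stateRule, weightA, weightK]
  | (.num k, l) => simp [stateRule, weightA, weightK, Function.comp_def, pow_succ']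

/-- Passing from (k, l) to (k + 1, l + 1) shifts the sum defining `weightD` and adds the single term
`X ^ l`. This closes the recurrences without tracking k. -/
theorem sum_weightD_stateRule (s : Label × ℕ) (hs : ∀ k, s.1 = .num k → 2 ≤ k) :
    ((stateRule s).map weightD).sum = weightD s + weightK s := by
  match s with
  | (.oneA, l) => simp [stateRule, weightD, weightK]
  | (.oneB, l) => simp [stateRule, weightD, weightK]
  | (.num k, l) =>
    have hk := hs k rfl
    obtain ⟨m, rfl⟩ := Nat.exists_eq_add_of_le' hk
    simp only [stateRule, weightD, weightK, Function.comp_def, Multiset.map_add, Multiset.map_map,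
      Multiset.sum_add, Multiset.insert_eq_cons, Multiset.map_cons, Multiset.map_singleton,
      Multiset.sum_cons, Multiset.sum_singleton, Multiset.map_const', Multiset.sum_replicate,
      smul_zero, zero_add]
    rw [show m + 2 + 1 - 2 = m + 1 by omega, Finset.sum_range_succ']
    simp only [Nat.add_sub_cancel, Nat.sub_zero, add_left_inj]
    exact Finset.sum_congr rfl fun j _ => by rw [Nat.sub_sub, add_comm]

theorem sum_F_succ {M : Type*} [AddCommMonoid M] (n : ℕ) (f : Equiv.Perm (Fin (n + 1)) → M) :
    ∑ τ ∈ F (n + 1), f τ = ∑ π ∈ F n, ∑ i ∈ activeSites F π, f (insertMax π i) := by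
  rw [Finset.sum_sigma']
  symm
  refine Finset.sum_bij (fun p _ => insertMax p.1 p.2) ?_ ?_ ?_ ?_
  · intro p hp
    simp only [Finset.mem_sigma, activeSites, Finset.mem_filter, Finset.mem_univ, true_and] at hp
    exact hp.2
  · rintro ⟨π, i⟩ _ ⟨σ, j⟩ _ h
    have := insertMax_injective n (a₁ := (π, i)) (a₂ := (σ, j)) h
    rw [Prod.mk.injEq] at this
    obtain ⟨rfl, rfl⟩ := this
    rfl
  · intro τ hτ
    obtain ⟨⟨π, i⟩, rfl⟩ := (insertMax_bijective n).2 τ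
    refine ⟨⟨π, i⟩, ?_, rfl⟩
    simp only [Finset.mem_sigma, activeSites, Finset.mem_filter, Finset.mem_univ, true_and]
    exact ⟨((insertMax_mem_F_iff π i).1 hτ).1, hτ⟩
  · intro p _
    rfl

/-- The sum of a weight over the permutations of length `n`. -/
noncomputable def total (f : Label × ℕ → Polynomial ℤ) (n : ℕ) : Polynomial ℤ :=
  ∑ π ∈ F n, f (state n π)

theorem total_succ (f : Label × ℕ → Polynomial ℤ) (n : ℕ) :
    total f (n + 1) = ∑ π ∈ F n, ((stateRule (state n π)).map f).sum := by
  rw [total, sum_F_succ]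
  refine Finset.sum_congr rfl fun π hπ => ?_
  rw [← map_state_activeSites hπ, Multiset.map_map]
  rfl

theorem F_zero : F 0 = {1} := by
  ext π
  rw [Finset.mem_singleton, mem_F_iff, isFishburn_iff, not_contains_321_iff, not_contains_3124_iff]
  exact ⟨fun _ => Subsingleton.elim _ _, fun _ => ⟨fun a => a.elim0, fun a => a.elim0,
    fun a => a.elim0⟩⟩

theorem state_zero (π : Equiv.Perm (Fin 0)) : state 0 π = (.oneA, 0) := by
  have hπ : π ∈ F 0 := by rw [F_zero, Finset.mem_singleton]; exact Subsingleton.elim _ _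
  rw [state, (hasLabel_iff hπ .oneA).1 (Or.inl rfl)]
  rfl

theorem total_zero (f : Label × ℕ → Polynomial ℤ) : total f 0 = f (.oneA, 0) := by
  rw [total, F_zero, Finset.sum_singleton, state_zero]

theorem total_weightA_succ (n : ℕ) : total weightA (n + 1) = total weightK n := by
  rw [total_succ]
  simp only [sum_weightA_stateRule, total]

theorem total_weightB_succ (n : ℕ) :
    total weightB (n + 1) = Polynomial.X * total weightB n + total weightD n := by
  rw [total_succ]
  simp only [sum_weightB_stateRule, total, Finset.sum_add_distrib, Finset.mul_sum]

theorem total_weightK_succ (n : ℕ) :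
    total weightK (n + 1) = Polynomial.X * (total weightA n + total weightK n) := by
  rw [total_succ]
  simp only [sum_weightK_stateRule, total, ← Finset.sum_add_distrib, Finset.mul_sum]

theorem total_weightD_succ (n : ℕ) :
    total weightD (n + 1) = total weightD n + total weightK n := by
  rw [total_succ, total, total, ← Finset.sum_add_distrib]
  refine Finset.sum_congr rfl fun π hπ => sum_weightD_stateRule _ fun k hk => ?_
  have := hasLabel_label hπ
  rw [show label n π = .num k from hk] at this
  exact this.1

theorem total_add (n : ℕ) : total weightA n + total weightB n + total weightK n =
    ∑ π ∈ F n, Polynomial.X ^ ltrMax π := by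
  simp only [total, ← Finset.sum_add_distrib, weight_add, state]

/-! ### The generating function -/

theorem T_eq : T = PowerSeries.mk (total weightA) + PowerSeries.mk (total weightB) +
    PowerSeries.mk (total weightK) := by
  ext1 n
  simp only [T, map_add, PowerSeries.coeff_mk, total_add]

theorem T_mul_eq (t x : PowerSeries (Polynomial ℤ)) (ht : t = PowerSeries.C Polynomial.X)
    (hx : x = PowerSeries.X) :
    T * ((1 - t * x - t * x ^ 2) * (1 - t * x) * (1 - x)) =
      1 - (t + 1) * x + t * x ^ 2 + t * x ^ 3 := by
  have hA : PowerSeries.mk (total weightA) = 1 + x * PowerSeries.mk (total weightK) := by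
    ext1 n
    rcases n with _ | n
    · simp [hx, total_zero, weightA]
    · simp [hx, PowerSeries.coeff_succ_X_mul, total_weightA_succ, PowerSeries.coeff_one]
  have hB : PowerSeries.mk (total weightB) =
      x * (t * PowerSeries.mk (total weightB) + PowerSeries.mk (total weightD)) := by
    ext1 n
    rcases n with _ | n
    · simp [hx, total_zero, weightB]
    · simp [hx, ht, PowerSeries.coeff_succ_X_mul, total_weightB_succ]
  have hK : PowerSeries.mk (total weightK) =
      x * (t * (PowerSeries.mk (total weightA) + PowerSeries.mk (total weightK))) := by
    ext1 n
    rcases n with _ | n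
    · simp [hx, total_zero, weightK]
    · simp [hx, ht, PowerSeries.coeff_succ_X_mul, total_weightK_succ]
  have hD : PowerSeries.mk (total weightD) =
      x * (PowerSeries.mk (total weightD) + PowerSeries.mk (total weightK)) := by
    ext1 n
    rcases n with _ | n
    · simp [hx, total_zero, weightD]
    · simp [hx, PowerSeries.coeff_succ_X_mul, total_weightD_succ]
  rw [T_eq]
  generalize PowerSeries.mk (total weightA) = A at *
  generalize PowerSeries.mk (total weightB) = B at *
  generalize PowerSeries.mk (total weightK) = K at *
  generalize PowerSeries.mk (total weightD) = D at *
  clear ht hx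
  have hKQ : K * (1 - t * x - t * x ^ 2) = t * x := by linear_combination hK + t * x * hA
  -- Here A + K = 1 + (1 + x)K, while (1 - tx)B = xD and (1 - x)D = xK contribute x²K to the cleared
  -- sum.
  linear_combination (1 - t * x - t * x ^ 2) * (1 - t * x) * (1 - x) * hA +
    ((1 + x) * (1 - t * x) * (1 - x) + x ^ 2) * hKQ +
    (1 - t * x - t * x ^ 2) * (1 - x) * hB + (1 - t * x - t * x ^ 2) * x * hD

theorem isUnit_denominator (t : PowerSeries (Polynomial ℤ)) :
    IsUnit ((1 - t * PowerSeries.X - t * PowerSeries.X ^ 2) * (1 - t * PowerSeries.X) *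
      (1 - PowerSeries.X)) := by
  rw [PowerSeries.isUnit_iff_constantCoeff]
  simp

/-! ### Enumeration at t = 1 -/

theorem eval_total (n : ℕ) :
    (total weightK n).eval 1 = Nat.fib n ∧
    (total weightA n + total weightK n).eval 1 = Nat.fib (n + 1) ∧
    (total weightD n).eval 1 = (Nat.fib (n + 1) : ℤ) - 1 ∧
    (total weightB n).eval 1 = (Nat.fib (n + 2) : ℤ) - 1 - n := by
  induction n with
  | zero => simp [total_zero, weightA, weightB, weightK, weightD]
  | succ n ih =>
    obtain ⟨hK, hA, hD, hB⟩ := ih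
    have h2 : (Nat.fib (n + 2) : ℤ) = Nat.fib n + Nat.fib (n + 1) := by
      rw [Nat.fib_add_two]; push_cast; ring
    have h3 : (Nat.fib (n + 3) : ℤ) = Nat.fib (n + 1) + Nat.fib (n + 2) := by
      rw [Nat.fib_add_two]; push_cast; ring
    simp only [total_weightA_succ, total_weightB_succ, total_weightK_succ, total_weightD_succ,
      Polynomial.eval_add, Polynomial.eval_mul, Polynomial.eval_X] at *
    refine ⟨by linarith, by linarith, by linarith, ?_⟩
    push_cast
    linarith

theorem card_F (n : ℕ) : ((F n).card : ℤ) = (fibonacci (n + 2) : ℤ) - n - 1 := by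
  have h := congrArg (Polynomial.eval 1) (total_add n)
  obtain ⟨-, hA, -, hB⟩ := eval_total n
  rw [Polynomial.eval_add] at hA
  simp only [Polynomial.eval_add, Polynomial.eval_finsetSum, Polynomial.eval_pow,
    Polynomial.eval_X, one_pow, Finset.sum_const, nsmul_eq_mul, mul_one] at h
  have h3 : (Nat.fib (n + 3) : ℤ) = Nat.fib (n + 1) + Nat.fib (n + 2) := by
    rw [Nat.fib_add_two]; push_cast; ring
  rw [fibonacci, ← h, h3]
  linarith

/-! ### The generating tree -/

theorem map_fst_stateRule (s : Label × ℕ) : (stateRule s).map Prod.fst = rule s.1 := by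
  match s with
  | (.oneA, l) => simp [stateRule, rule]
  | (.oneB, l) => simp [stateRule, rule]
  | (.num k, l) => simp [stateRule, rule]

theorem one_mem_F (n : ℕ) : (1 : Equiv.Perm (Fin n)) ∈ F n := by
  rw [mem_F_iff, isFishburn_iff, not_contains_321_iff, not_contains_3124_iff]
  simp only [Equiv.Perm.one_apply, Fin.lt_def]
  exact ⟨by omega, by omega, by omega⟩

theorem hasLabel_one {n : ℕ} (hn : 1 ≤ n) :
    HasLabel (1 : Equiv.Perm (Fin n)) (.num (n + 1)) := by
  refine ⟨by omega, le_rfl, ?_, fun i _ => rfl, fun i hi => by omega⟩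
  rw [not_contains_312_iff]
  simp only [Equiv.Perm.one_apply, Fin.lt_def]
  omega

theorem F_one : F 1 = {1} := by
  ext π
  rw [Finset.mem_singleton]
  exact ⟨fun _ => Subsingleton.elim _ _, fun h => h ▸ one_mem_F 1⟩

theorem isGeneratingTree : IsGeneratingTree F label (.num 2) rule := by
  refine ⟨?_, fun n _ τ hτ => ?_, fun n _ π hπ => ?_⟩
  · rw [F_one, Finset.singleton_val, Multiset.map_singleton,
      (hasLabel_iff (one_mem_F 1) _).1 (hasLabel_one le_rfl)]
  · obtain ⟨p, rfl⟩ := (insertMax_bijective n).2 τ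
    exact ⟨p, ⟨((insertMax_mem_F_iff _ _).1 hτ).1, rfl⟩,
      fun q hq => (insertMax_bijective n).1 hq.2⟩
  · have := congrArg (Multiset.map Prod.fst) (map_state_activeSites hπ)
    rwa [Multiset.map_map, map_fst_stateRule] at this

/-- The identities alone realise every label (k) with k ≥ 2. -/
theorem infinite_labels :
    {l : Label | ∃ n : ℕ, 1 ≤ n ∧ ∃ π ∈ F n, label n π = l}.Infinite := by
  refine Set.infinite_of_injective_forall_mem (f := fun n : ℕ => Label.num (n + 2))
    (fun a b h => by simpa using h) fun n => ?_
  exact ⟨n + 1, by omega, 1, one_mem_F _, (hasLabel_iff (one_mem_F _) _).1 (hasLabel_one (by omega))⟩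

end FishburnTree

theorem mainTheorem8 :
    -- the generating tree, whose labels are infinite in number
    (∃ lbl : (n : ℕ) → Equiv.Perm (Fin n) → FishburnTree.Label,
      (∀ n : ℕ, ∀ π ∈ FishburnTree.F n, ∀ l : FishburnTree.Label,
        FishburnTree.HasLabel π l ↔ lbl n π = l) ∧
      FishburnTree.IsGeneratingTree FishburnTree.F lbl (FishburnTree.Label.num 2)
        FishburnTree.rule ∧
      {l : FishburnTree.Label | ∃ n : ℕ, 1 ≤ n ∧ ∃ π ∈ FishburnTree.F n, lbl n π = l}.Infinite) ∧
    -- the generating function, as a quotient in `ℤ[t]⟦x⟧` by an invertible denominator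
    (∀ t x : PowerSeries (Polynomial ℤ),
      t = PowerSeries.C Polynomial.X → x = PowerSeries.X →
        IsUnit ((1 - t * x - t * x ^ 2) * (1 - t * x) * (1 - x)) ∧
        FishburnTree.T * ((1 - t * x - t * x ^ 2) * (1 - t * x) * (1 - x)) =
          1 - (t + 1) * x + t * x ^ 2 + t * x ^ 3) ∧
    -- the enumeration
    (∀ n : ℕ, ((FishburnTree.F n).card : ℤ) = (FishburnTree.fibonacci (n + 2) : ℤ) - n - 1) := by
  refine ⟨⟨FishburnTree.label, fun n π hπ l => FishburnTree.hasLabel_iff hπ l,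
    FishburnTree.isGeneratingTree, FishburnTree.infinite_labels⟩, fun t x ht hx => ⟨?_, ?_⟩,
    FishburnTree.card_F⟩
  · rw [hx]
    exact FishburnTree.isUnit_denominator t
  · exact FishburnTree.T_mul_eq t x ht hx
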